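/- Let $\mathbf{Top}$ be the category of topological spaces and continuous maps. *Vietoris functors.* The compact Vietoris functor $\mathcal V:\mathbf{Top}\to\mathbf{Top}$ sends $X$ to the set of its compact subsets, with the topology generated by the sets $U^{\Box}=\{K\mid K\subseteq U\}$ and $U^{\Diamond}=\{K\mid K\cap U\neq\varnothing\}$ for $U\subseteq X$ open, and sends $f$ to $K\mapsto f[K]$. The lower Vietoris functor sends $X$ to the set of its closed subsets, with the topology generated by the sets $U^{\Diamond}$, $U\subseteq X$ open, and sends $f$ to $A\mapsto\overline{f[A]}$. The compact (respectively lower) Vietoris polynomial functors are the functors $\mathbf{Top}\to\mathbf{Top}$ generated, up to natural isomorphism, by the grammar $$F ::= F+F \mid F\times F \mid A \mid \mathrm{Id} \mid \mathcal V,$$ where $A$ ranges over the constant functors and $\mathcal V$ is the compact (respectively lower) Vietoris functor. *Stably compact spaces.* A subset of a space is saturated if it is an intersection of open sets. A space is stably compact if it is $T_0$, locally compact, well-filtered, and all finite intersections (including the empty one) of compact saturated subsets are compact. A continuous map between stably compact spaces is spectral if preimages of compact saturated sets are compact. These form the category $\mathbf{StablyComp}$; $\mathbf{Haus}$ is the full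 subcategory of $\mathbf{Top}$ of Hausdorff spaces. A functor $F:\mathbf{Top}\to\mathbf{Top}$ can be restricted to one of these subcategories if it maps its objects to its objects and its morphisms to its morphisms. A final coalgebra of $G:\mathbf{Top}\to\mathbf{Top}$ is a terminal object of the category of all $G$-coalgebras $X\to GX$ in $\mathbf{Top}$. **Corollary.** 1. Let $F$ be a compact Vietoris polynomial functor that can be restricted to $\mathbf{Haus}$. Every subfunctor $G$ of $F$, i.e. every functor $G:\mathbf{Top}\to\mathbf{Top}$ with a natural transformation $G\to F$ whose components are monomorphisms (in particular, every one whose components are subspace embeddings), admits a final coalgebra. 2. In particular, the functors that send $X$ to the subspace of the compact Vietoris space $\mathcal VX$ given by (a) the nonempty compact sets, (b) the finite sets, (c) the nonempty connected compact sets, and that act on maps by direct image, are subfunctors (with subspace embeddings as components) of the compact Vietoris functor, and each of them admits a final coalgebra. Moreover, every functor generated, up to natural isomorphism, from constant functors, $\mathrm{Id}$, the compact Vietoris functor and these three variants by finite sums and products admits a natural transformation, with subspace embeddings as components, to some compact Vietoris polynomial functor. 3. Let $F$ be a lower Vietoris polynomial functor that can be restricted to $\mathbf{StablyComp}$. Every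 functor $G:\mathbf{Top}\to\mathbf{Top}$ with a natural transformation $G\to F$ whose components are subspace embeddings admits a final coalgebra. -/

import Mathlib

open CategoryTheory CategoryTheory.Limits TopologicalSpace Topology

universe u

/-! ### Vietoris functors -/

/-- The compact Vietoris functor: `X` is sent to the space of its compact subsets, with the topology
generated by the sets `{K | K ⊆ U}` and `{K | (K ∩ U).Nonempty}` for `U` open (this is the topology
that Mathlib puts on `Compacts X`), and `f` acts by direct image. -/
def compactVietoris : TopCat.{u} ⥤ TopCat.{u} where
  obj X := TopCat.of (Compacts X)
  map f := TopCat.ofHom ⟨Compacts.map f.hom f.hom.continuous, f.hom.continuous.compacts_map⟩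
  map_id X := by
    ext K : 1
    exact Compacts.ext (by simp)
  map_comp f g := by
    ext K : 1
    exact Compacts.ext (by simp [Set.image_image])

/-- The set of closed subsets of `X`, carrier of the lower Vietoris space. -/
def LowerVietorisSpace (X : Type u) [TopologicalSpace X] : Type u := Closeds X

/-- The lower Vietoris topology, generated by the sets `{A | (A ∩ U).Nonempty}` for `U` open. -/
instance (X : Type u) [TopologicalSpace X] : TopologicalSpace (LowerVietorisSpace X) :=
  .generateFrom
    {s | ∃ U : Set X, IsOpen U ∧ s = {A : Closeds X | ((A : Set X) ∩ U).Nonempty}}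

/-- The action of a map on closed sets: `A` is sent to the closure of its image. -/
def LowerVietorisSpace.map {X Y : Type u} [TopologicalSpace X] [TopologicalSpace Y] (f : X → Y)
    (A : LowerVietorisSpace X) : LowerVietorisSpace Y :=
  Closeds.closure (f '' SetLike.coe (show Closeds X from A))

theorem LowerVietorisSpace.continuous_map {X Y : Type u} [TopologicalSpace X] [TopologicalSpace Y]
    {f : X → Y} (hf : Continuous f) : Continuous (LowerVietorisSpace.map f) := by
  refine continuous_generateFrom_iff.2 ?_
  rintro _ ⟨U, hU, rfl⟩
  refine isOpen_generateFrom_of_mem ⟨f ⁻¹' U, hU.preimage hf, ?_⟩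
  ext A
  change (closure (f '' SetLike.coe (show Closeds X from A)) ∩ U).Nonempty ↔
    (SetLike.coe (show Closeds X from A) ∩ f ⁻¹' U).Nonempty
  rw [closure_inter_open_nonempty_iff hU, Set.image_inter_nonempty_iff]

/-- The lower Vietoris functor. -/
def lowerVietoris : TopCat.{u} ⥤ TopCat.{u} where
  obj X := TopCat.of (LowerVietorisSpace X)
  map f := TopCat.ofHom ⟨LowerVietorisSpace.map f.hom,
    LowerVietorisSpace.continuous_map f.hom.continuous⟩
  map_id X := by
    ext A : 1
    refine Closeds.ext ?_
    change closure ((fun x => x) '' SetLike.coe (show Closeds X from A)) = _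
    rw [Set.image_id', (show Closeds X from A).isClosed.closure_eq]
    rfl
  map_comp {X Y Z} f g := by
    ext A : 1
    refine Closeds.ext ?_
    change closure ((fun x => g.hom (f.hom x)) '' SetLike.coe (show Closeds X from A)) =
      closure (g.hom '' closure (f.hom '' SetLike.coe (show Closeds X from A)))
    rw [closure_image_closure g.hom.continuous, Set.image_image]

/-- The variant of the compact Vietoris functor which only keeps the compact sets satisfying a
property that is stable under continuous images, with the subspace topology. -/
def compactVietorisOf (P : ∀ X : TopCat.{u}, Set X → Prop)
    (hP : ∀ (X Y : TopCat.{u}) (f : X ⟶ Y) (K : Set X), P X K → P Y (f.hom '' K)) :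
    TopCat.{u} ⥤ TopCat.{u} where
  obj X := TopCat.of {K : Compacts X // P X K}
  map {X Y} f := TopCat.ofHom
    ⟨fun K => ⟨Compacts.map f.hom f.hom.continuous K.1, hP X Y f K.1 K.2⟩,
      (f.hom.continuous.compacts_map.comp continuous_subtype_val).subtype_mk _⟩
  map_id X := by
    ext K : 1
    exact Subtype.ext (Compacts.ext (by simp))
  map_comp f g := by
    ext K : 1
    exact Subtype.ext (Compacts.ext (by simp [Set.image_image]))

/-- The space of nonempty compact subsets. -/
def nonemptyCompactVietoris : TopCat.{u} ⥤ TopCat.{u} :=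
  compactVietorisOf (fun _ K => K.Nonempty) fun _ _ f _ h => h.image f.hom

/-- The space of finite subsets. -/
def finiteCompactVietoris : TopCat.{u} ⥤ TopCat.{u} :=
  compactVietorisOf (fun _ K => K.Finite) fun _ _ f _ h => h.image f.hom

/-- The space of (nonempty) connected compact subsets. -/
def connectedCompactVietoris : TopCat.{u} ⥤ TopCat.{u} :=
  compactVietorisOf (fun _ K => IsConnected K) fun _ _ f _ h =>
    h.image f.hom f.hom.continuous.continuousOn

/-! ### Polynomial functors -/

/-- The pointwise sum of two endofunctors of `Top`. -/
def sumFunctor (F G : TopCat.{u} ⥤ TopCat.{u}) : TopCat.{u} ⥤ TopCat.{u} where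
  obj X := TopCat.of (F.obj X ⊕ G.obj X)
  map f := TopCat.ofHom ⟨Sum.map (F.map f).hom (G.map f).hom,
    (F.map f).hom.continuous.sumMap (G.map f).hom.continuous⟩
  map_id X := by ext (x | x) <;> simp
  map_comp f g := by ext (x | x) <;> simp

/-- The pointwise product of two endofunctors of `Top`. -/
def prodFunctor (F G : TopCat.{u} ⥤ TopCat.{u}) : TopCat.{u} ⥤ TopCat.{u} where
  obj X := TopCat.of (F.obj X × G.obj X)
  map f := TopCat.ofHom ⟨Prod.map (F.map f).hom (G.map f).hom,
    (F.map f).hom.continuous.prodMap (G.map f).hom.continuous⟩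
  map_id X := by ext x <;> simp
  map_comp f g := by ext x <;> simp

/-- The functors generated by the grammar `F ::= F + F | F × F | A | Id | V`, where `A` ranges over
all (constant) topological spaces and `V` over the class `𝒱`. Sums and products of functors are only
determined up to isomorphism, so the class is closed under natural isomorphism. -/
inductive IsPolynomialOver (𝒱 : Set (TopCat.{u} ⥤ TopCat.{u})) :
    (TopCat.{u} ⥤ TopCat.{u}) → Prop
  | sum {F G : TopCat.{u} ⥤ TopCat.{u}} :
      IsPolynomialOver 𝒱 F → IsPolynomialOver 𝒱 G → IsPolynomialOver 𝒱 (sumFunctor F G)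
  | prod {F G : TopCat.{u} ⥤ TopCat.{u}} :
      IsPolynomialOver 𝒱 F → IsPolynomialOver 𝒱 G → IsPolynomialOver 𝒱 (prodFunctor F G)
  | const (A : TopCat.{u}) : IsPolynomialOver 𝒱 ((Functor.const TopCat.{u}).obj A)
  | id : IsPolynomialOver 𝒱 (𝟭 TopCat.{u})
  | vietoris {V : TopCat.{u} ⥤ TopCat.{u}} : V ∈ 𝒱 → IsPolynomialOver 𝒱 V
  | iso {F G : TopCat.{u} ⥤ TopCat.{u}} :
      (F ≅ G) → IsPolynomialOver 𝒱 F → IsPolynomialOver 𝒱 G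

/-- Compact Vietoris polynomial functors. -/
def IsCompactVietorisPolynomial (F : TopCat.{u} ⥤ TopCat.{u}) : Prop :=
  IsPolynomialOver {compactVietoris} F

/-- Lower Vietoris polynomial functors. -/
def IsLowerVietorisPolynomial (F : TopCat.{u} ⥤ TopCat.{u}) : Prop :=
  IsPolynomialOver {lowerVietoris} F

/-! ### Subcategories of `Top` to which a functor may restrict -/

/-- `F` restricts to the full subcategory of Hausdorff spaces. -/
def RestrictsToHaus (F : TopCat.{u} ⥤ TopCat.{u}) : Prop :=
  ∀ X : TopCat.{u}, T2Space X → T2Space (F.obj X)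

/-- A set is saturated if it is the intersection of its open neighbourhoods. -/
def IsSaturated {X : Type u} [TopologicalSpace X] (s : Set X) : Prop :=
  nhdsKer s = s

/-- Stably compact spaces. Finite intersections include the empty one, i.e. the whole space. -/
structure IsStablyCompact (X : Type u) [TopologicalSpace X] : Prop where
  t0 : T0Space X
  locallyCompact : LocallyCompactSpace X
  wellFiltered : ∀ 𝒦 : Set (Set X), 𝒦.Nonempty → DirectedOn (· ⊇ ·) 𝒦 →
    (∀ K ∈ 𝒦, IsCompact K ∧ IsSaturated K) →
    ∀ U : Set X, IsOpen U → ⋂₀ 𝒦 ⊆ U → ∃ K ∈ 𝒦, K ⊆ U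
  coherent : ∀ 𝒦 : Set (Set X), 𝒦.Finite →
    (∀ K ∈ 𝒦, IsCompact K ∧ IsSaturated K) → IsCompact (⋂₀ 𝒦)

/-- Spectral maps between (stably compact) spaces: continuous maps for which preimages of compact
saturated sets are compact. -/
def IsSpectralMorphism {X Y : TopCat.{u}} (f : X ⟶ Y) : Prop :=
  ∀ K : Set Y, IsCompact K → IsSaturated K → IsCompact (f.hom ⁻¹' K)

/-- `F` restricts to the (non-full) subcategory of stably compact spaces and spectral maps. -/
def RestrictsToStablyComp (F : TopCat.{u} ⥤ TopCat.{u}) : Prop :=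
  (∀ X : TopCat.{u}, IsStablyCompact X → IsStablyCompact (F.obj X)) ∧
  ∀ (X Y : TopCat.{u}) (f : X ⟶ Y), IsStablyCompact X → IsStablyCompact Y →
    IsSpectralMorphism f → IsSpectralMorphism (F.map f)

/-! ### Subfunctors and final coalgebras -/

/-- `G` is a subfunctor of `F` in the sense of subobjects of functors: there is a natural
transformation all of whose components are monomorphisms of `Top`. -/
def IsMonoSubfunctor (G F : TopCat.{u} ⥤ TopCat.{u}) : Prop :=
  ∃ σ : G ⟶ F, ∀ X : TopCat.{u}, Mono (σ.app X)

/-- `G` is a subfunctor of `F` in the sense of subspaces: there is a natural transformation all of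
whose components are topological embeddings. -/
def IsEmbeddedSubfunctor (G F : TopCat.{u} ⥤ TopCat.{u}) : Prop :=
  ∃ σ : G ⟶ F, ∀ X : TopCat.{u}, IsEmbedding (σ.app X)

/-- The category of coalgebras of `F`, over all topological spaces, has a final object. -/
def HasFinalCoalgebra (F : TopCat.{u} ⥤ TopCat.{u}) : Prop :=
  HasTerminal (Endofunctor.Coalgebra F)

/-! If an endofunctor `F` preserves the limit `L` of its final sequence `1 ⟵ F 1 ⟵ F (F 1) ⟵ ⋯`, the
cone of projections shifted by one lifts to a structure map `L ⟶ F L`, and this coalgebra is final.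
Sums and products preserve such limits whenever their parts do, so for a polynomial functor only the
Vietoris functor on this one sequence has to be treated. The restriction hypothesis makes the
sequence Hausdorff, respectively stably compact with spectral connecting maps.

In the Hausdorff case (`preservesSeqLimit_compactVietoris`), a thread of compact sets comes from the
trace of their product on `L`, a closed subspace of the product of all stages. In the stably compact
case (`preservesSeqLimit_lowerVietoris`), the patch topologies are compact Hausdorff and make the
connecting maps continuous. Partial threads through closed sets then yield full threads by
compactness.

To pass to a subfunctor `G`, the behaviour map of a `G`-coalgebra into the final `F`-coalgebra `Z`
is factored as a surjection followed by an injection, and a diagonal fill-in makes the middle object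
a `G`-coalgebra (`exists_coalgebra_factorization`). The middle objects are, up to isomorphism,
subsets of `Z` with some topology, so they form a small set. The image in `Z` of their coproduct is
weakly final, and its injection into `Z` forces uniqueness (`hasFinalCoalgebra_of_factorization`).
-/

/-! ### Limits of sequences of spaces -/

/-- The space `L` with the projections `π` is a limit of the sequence `D 0 ⟵ D 1 ⟵ ⋯`. -/
structure IsSeqLimit (D : ℕ → TopCat.{u}) (p : ∀ n, D (n + 1) ⟶ D n) (L : TopCat.{u})
    (π : ∀ n, L ⟶ D n) : Prop where
  compat : ∀ n, π (n + 1) ≫ p n = π n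
  injective : ∀ x y : L, (∀ n, π n x = π n y) → x = y
  exists_thread : ∀ s : ∀ n, D n, (∀ n, p n (s (n + 1)) = s n) → ∃ x : L, ∀ n, π n x = s n
  basis : ∀ U : Set L, IsOpen U → ∀ x ∈ U,
    ∃ n, ∃ W : Set (D n), IsOpen W ∧ π n x ∈ W ∧ π n ⁻¹' W ⊆ U

section SeqLimit

variable {D : ℕ → TopCat.{u}} {p : ∀ n, D (n + 1) ⟶ D n} {L : TopCat.{u}} {π : ∀ n, L ⟶ D n}

/-- Pulling back along the connecting maps moves an open set to any later stage. Finitely many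
conditions can thus be placed at one common stage. -/
theorem exists_isOpen_preimage_eq_of_le (hπ : ∀ n, π (n + 1) ≫ p n = π n) {n m : ℕ} (hnm : n ≤ m)
    {W : Set (D n)} (hW : IsOpen W) : ∃ W' : Set (D m), IsOpen W' ∧ π m ⁻¹' W' = π n ⁻¹' W := by
  induction m, hnm using Nat.le_induction with
  | base => exact ⟨W, hW, rfl⟩
  | succ m _ ih =>
    obtain ⟨W', hW', h⟩ := ih
    refine ⟨p m ⁻¹' W', hW'.preimage (p m).hom.continuous, ?_⟩
    rw [← h, ← hπ m]
    rfl

theorem exists_common_basis (hπ : ∀ n, π (n + 1) ≫ p n = π n) {n m : ℕ} {x : L}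
    {W : Set (D n)} (hW : IsOpen W) (hx : π n x ∈ W)
    {W' : Set (D m)} (hW' : IsOpen W') (hx' : π m x ∈ W') :
    ∃ k, ∃ V V' : Set (D k), IsOpen V ∧ IsOpen V' ∧ π k x ∈ V ∧ π k x ∈ V' ∧
      π k ⁻¹' V = π n ⁻¹' W ∧ π k ⁻¹' V' = π m ⁻¹' W' := by
  obtain ⟨V, hV, h⟩ := exists_isOpen_preimage_eq_of_le hπ (le_max_left n m) hW
  obtain ⟨V', hV', h'⟩ := exists_isOpen_preimage_eq_of_le hπ (le_max_right n m) hW'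
  refine ⟨_, V, V', hV, hV', ?_, ?_, h, h'⟩
  · change x ∈ π _ ⁻¹' V
    rwa [h]
  · change x ∈ π _ ⁻¹' V'
    rwa [h']

/-- Reduces the `basis` field of `IsSeqLimit` to a subbasis: finite intersections are handled at a
common stage. -/
theorem seq_basis_of_generateFrom (hπ : ∀ n, π (n + 1) ≫ p n = π n) {S : Set (Set L)}
    (hS : L.str = generateFrom S)
    (h : ∀ U ∈ S, ∀ x ∈ U, ∃ n, ∃ W : Set (D n), IsOpen W ∧ π n x ∈ W ∧ π n ⁻¹' W ⊆ U)
    (U : Set L) (hU : IsOpen U) (x : L) (hx : x ∈ U) :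
    ∃ n, ∃ W : Set (D n), IsOpen W ∧ π n x ∈ W ∧ π n ⁻¹' W ⊆ U := by
  have hU' : GenerateOpen S U := by
    change IsOpen[L.str] U at hU
    rwa [hS] at hU
  induction hU' with
  | basic U hU' => exact h U hU' x hx
  | univ => exact ⟨0, Set.univ, isOpen_univ, trivial, Set.subset_univ _⟩
  | inter U V hU' hV' ihU ihV =>
    obtain ⟨n, W, hW, hxW, hWU⟩ := ihU (by rwa [hS]) hx.1
    obtain ⟨m, W', hW', hxW', hWV⟩ := ihV (by rwa [hS]) hx.2
    obtain ⟨k, A, B, hA, hB, hxA, hxB, eA, eB⟩ := exists_common_basis hπ hW hxW hW' hxW'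
    exact ⟨k, A ∩ B, hA.inter hB, ⟨hxA, hxB⟩, fun y hy =>
      ⟨hWU (eA ▸ hy.1 : y ∈ π n ⁻¹' W), hWV (eB ▸ hy.2 : y ∈ π m ⁻¹' W')⟩⟩
  | sUnion 𝒰 h𝒰 ih =>
    obtain ⟨U, hU', hxU⟩ := hx
    obtain ⟨n, W, hW, hxW, hWU⟩ := ih U hU' (by rw [hS]; exact h𝒰 U hU') hxU
    exact ⟨n, W, hW, hxW, hWU.trans (Set.subset_sUnion_of_mem hU')⟩

theorem IsSeqLimit.exists_isOpen_preimage_eq (h : IsSeqLimit D p L π) {n m : ℕ} (hnm : n ≤ m)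
    {W : Set (D n)} (hW : IsOpen W) : ∃ W' : Set (D m), IsOpen W' ∧ π m ⁻¹' W' = π n ⁻¹' W :=
  exists_isOpen_preimage_eq_of_le h.compat hnm hW

theorem IsSeqLimit.hom_ext (h : IsSeqLimit D p L π) {X : TopCat.{u}} {f g : X ⟶ L}
    (hfg : ∀ n, f ≫ π n = g ≫ π n) : f = g := by
  ext x
  exact h.injective _ _ fun n => ConcreteCategory.congr_hom (hfg n) x

theorem IsSeqLimit.exists_lift (h : IsSeqLimit D p L π) {X : TopCat.{u}} (f : ∀ n, X ⟶ D n)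
    (hf : ∀ n, f (n + 1) ≫ p n = f n) : ∃ g : X ⟶ L, ∀ n, g ≫ π n = f n := by
  choose g hg using fun x : X => h.exists_thread (fun n => f n x)
    fun n => ConcreteCategory.congr_hom (hf n) x
  refine ⟨TopCat.ofHom ⟨g, ?_⟩, fun n => by ext x; exact hg x n⟩
  refine continuous_iff_continuousAt.2 fun x U hU => ?_
  obtain ⟨V, hVU, hV, hx⟩ := mem_nhds_iff.1 hU
  obtain ⟨n, W, hW, hxW, hWV⟩ := h.basis V hV (g x) hx
  rw [hg x n] at hxW
  rw [Filter.mem_map]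
  filter_upwards [(hW.preimage (f n).hom.continuous).mem_nhds hxW] with y hy
  refine hVU (hWV ?_)
  change π n (g y) ∈ W
  rw [hg y n]
  exact hy

end SeqLimit

theorem exists_isSeqLimit (D : ℕ → TopCat.{u}) (p : ∀ n, D (n + 1) ⟶ D n) :
    ∃ (L : TopCat.{u}) (π : ∀ n, L ⟶ D n), IsSeqLimit D p L π := by
  let T := {s : ∀ n, D n // ∀ n, p n (s (n + 1)) = s n}
  let π : ∀ n, TopCat.of T ⟶ D n := fun n =>
    TopCat.ofHom ⟨fun s => s.1 n, (continuous_apply n).comp continuous_subtype_val⟩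
  have compat : ∀ n, π (n + 1) ≫ p n = π n := fun n => by ext s; exact s.2 n
  refine ⟨TopCat.of T, π, compat, fun x y hxy => Subtype.ext (funext hxy),
    fun s hs => ⟨⟨s, hs⟩, fun n => rfl⟩, ?_⟩
  have hT : (TopCat.of T).str = generateFrom {U | ∃ n, ∃ W : Set (D n), IsOpen W ∧
      π n ⁻¹' W = U} := by
    change TopologicalSpace.induced _ (⨅ n, _) = _
    rw [induced_iInf]
    simp_rw [induced_compose]
    conv_lhs => enter [1, n]; rw [← generateFrom_setOfPred_isOpen (TopologicalSpace.induced _ _)]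
    rw [← generateFrom_iUnion]
    congr 1
    ext U
    simp only [Set.mem_iUnion, Set.mem_ofPred_eq, isOpen_induced_iff]
    rfl
  refine seq_basis_of_generateFrom compat hT ?_
  rintro _ ⟨n, W, hW, rfl⟩ x hx
  exact ⟨n, W, hW, hx, subset_rfl⟩

/-! ### The final sequence of an endofunctor -/

/-- `F` preserves the limit of the sequence `D 0 ⟵ D 1 ⟵ ⋯`. -/
def PreservesSeqLimit (F : TopCat.{u} ⥤ TopCat.{u}) (D : ℕ → TopCat.{u})
    (p : ∀ n, D (n + 1) ⟶ D n) : Prop :=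
  ∀ (L : TopCat.{u}) (π : ∀ n, L ⟶ D n), IsSeqLimit D p L π →
    IsSeqLimit (fun n => F.obj (D n)) (fun n => F.map (p n)) (F.obj L) (fun n => F.map (π n))

/-- The unique map to the one-point space. -/
def toPoint (X : TopCat.{u}) : X ⟶ TopCat.of PUnit.{u + 1} :=
  TopCat.ofHom ⟨fun _ => PUnit.unit, continuous_const⟩

/-- The final sequence `1 ⟵ F 1 ⟵ F (F 1) ⟵ ⋯`. -/
def finalSeq (F : TopCat.{u} ⥤ TopCat.{u}) : ℕ → TopCat.{u}
  | 0 => TopCat.of PUnit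
  | n + 1 => F.obj (finalSeq F n)

/-- The connecting maps of the final sequence. -/
def finalSeqMap (F : TopCat.{u} ⥤ TopCat.{u}) : ∀ n, finalSeq F (n + 1) ⟶ finalSeq F n
  | 0 => toPoint _
  | n + 1 => F.map (finalSeqMap F n)

/-- The cone over the final sequence given by a coalgebra. -/
def coalgebraCone {F : TopCat.{u} ⥤ TopCat.{u}} (C : Endofunctor.Coalgebra F) :
    ∀ n, C.V ⟶ finalSeq F n
  | 0 => toPoint _
  | n + 1 => C.str ≫ F.map (coalgebraCone C n)

theorem coalgebraCone_compat {F : TopCat.{u} ⥤ TopCat.{u}} (C : Endofunctor.Coalgebra F) :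
    ∀ n, coalgebraCone C (n + 1) ≫ finalSeqMap F n = coalgebraCone C n
  | 0 => rfl
  | n + 1 => by
    change (C.str ≫ F.map (coalgebraCone C (n + 1))) ≫ F.map (finalSeqMap F n) =
      C.str ≫ F.map (coalgebraCone C n)
    rw [Category.assoc, ← F.map_comp, coalgebraCone_compat C n]

/-- A functor that preserves the limit of its final sequence has a final coalgebra. -/
theorem PreservesSeqLimit.hasFinalCoalgebra {F : TopCat.{u} ⥤ TopCat.{u}}
    (hF : PreservesSeqLimit F (finalSeq F) (finalSeqMap F)) : HasFinalCoalgebra F := by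
  obtain ⟨L, π, hL⟩ := exists_isSeqLimit (finalSeq F) (finalSeqMap F)
  have hFL := hF L π hL
  -- The final sequence without its first term is the image under `F` of the whole sequence, so the
  -- shifted projections form a cone that lifts to `F.obj L`.
  obtain ⟨ζ, hζ⟩ := hFL.exists_lift (fun n => π (n + 1)) fun n => hL.compat (n + 1)
  have key : ∀ C : Endofunctor.Coalgebra F, ∃ b : C.V ⟶ L, (C.str ≫ F.map b = b ≫ ζ) ∧
      ∀ n, b ≫ π n = coalgebraCone C n := fun C => by
    obtain ⟨b, hb⟩ := hL.exists_lift (coalgebraCone C) (coalgebraCone_compat C)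
    refine ⟨b, hFL.hom_ext fun n => ?_, hb⟩
    rw [Category.assoc, ← F.map_comp, hb, Category.assoc, hζ]
    exact (hb (n + 1)).symm
  choose b hb hbπ using key
  refine IsTerminal.hasTerminal (X := (⟨L, ζ⟩ : Endofunctor.Coalgebra F))
    (IsTerminal.ofUniqueHom (fun C => ⟨b C, hb C⟩) fun C f => ?_)
  refine Endofunctor.Coalgebra.ext (hL.hom_ext fun n => ?_)
  change f.f ≫ π n = b C ≫ π n
  rw [hbπ]
  -- Any coalgebra morphism into `L` has prescribed components: stage 0 is a point, and the morphism
  -- square together with `hζ` determines stage `n + 1` from stage `n`.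
  induction n with
  | zero => rfl
  | succ n ih =>
    have e : f.f ≫ ζ ≫ F.map (π n) = C.str ≫ F.map (coalgebraCone C n) := by
      have hf : C.str ≫ F.map f.f = f.f ≫ ζ := f.h
      rw [← Category.assoc, ← hf, Category.assoc, ← F.map_comp, ih]
    rw [hζ] at e
    exact e

/-! ### Polynomial functors inherit properties from the functors they are built from -/

theorem PreservesSeqLimit.of_iso {F G : TopCat.{u} ⥤ TopCat.{u}} (e : F ≅ G) {D : ℕ → TopCat.{u}}
    {p : ∀ n, D (n + 1) ⟶ D n} (hF : PreservesSeqLimit F D p) : PreservesSeqLimit G D p := by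
  intro L π h
  have hL := hF L π h
  have nat : ∀ {X Y : TopCat.{u}} (f : X ⟶ Y) (x : F.obj X),
      G.map f (e.hom.app X x) = e.hom.app Y (F.map f x) := fun f x =>
    (ConcreteCategory.congr_hom (e.hom.naturality f) x).symm
  have nat' : ∀ {X Y : TopCat.{u}} (f : X ⟶ Y) (x : G.obj X),
      F.map f (e.inv.app X x) = e.inv.app Y (G.map f x) := fun f x =>
    (ConcreteCategory.congr_hom (e.inv.naturality f) x).symm
  have hi : ∀ (X : TopCat.{u}) (x : F.obj X), e.inv.app X (e.hom.app X x) = x := fun X x =>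
    ConcreteCategory.congr_hom (e.hom_inv_id_app X) x
  have ih : ∀ (X : TopCat.{u}) (x : G.obj X), e.hom.app X (e.inv.app X x) = x := fun X x =>
    ConcreteCategory.congr_hom (e.inv_hom_id_app X) x
  refine ⟨fun n => by rw [← G.map_comp, h.compat], fun x y hxy => ?_, fun s hs => ?_,
    fun U hU x hx => ?_⟩
  · rw [← ih L x, ← ih L y]
    congr 1
    refine hL.injective _ _ fun n => ?_
    rw [nat', nat', hxy]
  · obtain ⟨x, hx⟩ := hL.exists_thread (fun n => e.inv.app _ (s n)) fun n => by
      rw [nat', hs]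
    exact ⟨e.hom.app L x, fun n => by rw [nat, hx, ih]⟩
  · obtain ⟨n, W, hW, hxW, hWU⟩ := hL.basis _ (hU.preimage (e.hom.app L).hom.continuous)
      (e.inv.app L x) (by
        change e.hom.app L (e.inv.app L x) ∈ U
        rwa [ih])
    refine ⟨n, _, hW.preimage (e.inv.app (D n)).hom.continuous, ?_, fun y hy => ?_⟩
    · change e.inv.app (D n) (G.map (π n) x) ∈ W
      rwa [← nat']
    · have : e.inv.app L y ∈ F.map (π n) ⁻¹' W := by
        change F.map (π n) (e.inv.app L y) ∈ W
        rw [nat']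
        exact hy
      have h2 : e.hom.app L (e.inv.app L y) ∈ U := hWU this
      rwa [ih] at h2

theorem PreservesSeqLimit.prod {F G : TopCat.{u} ⥤ TopCat.{u}} {D : ℕ → TopCat.{u}}
    {p : ∀ n, D (n + 1) ⟶ D n} (hF : PreservesSeqLimit F D p) (hG : PreservesSeqLimit G D p) :
    PreservesSeqLimit (prodFunctor F G) D p := by
  intro L π h
  have hL := hF L π h
  have hL' := hG L π h
  refine ⟨fun n => by rw [← Functor.map_comp, h.compat], fun x y hxy => ?_, fun s hs => ?_,
    fun U hU x hx => ?_⟩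
  · exact Prod.ext (hL.injective _ _ fun n => congrArg Prod.fst (hxy n))
      (hL'.injective _ _ fun n => congrArg Prod.snd (hxy n))
  · obtain ⟨x, hx⟩ := hL.exists_thread (fun n => (s n).1) fun n => congrArg Prod.fst (hs n)
    obtain ⟨y, hy⟩ := hL'.exists_thread (fun n => (s n).2) fun n => congrArg Prod.snd (hs n)
    exact ⟨(x, y), fun n => Prod.ext (hx n) (hy n)⟩
  · obtain ⟨A, B, hA, hB, hxA, hxB, hAB⟩ := isOpen_prod_iff.1 hU x.1 x.2 hx
    obtain ⟨n, V, hV, hxV, hVA⟩ := hL.basis A hA x.1 hxA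
    obtain ⟨m, W, hW, hxW, hWB⟩ := hL'.basis B hB x.2 hxB
    obtain ⟨V', hV', eV⟩ := hL.exists_isOpen_preimage_eq (le_max_left n m) hV
    obtain ⟨W', hW', eW⟩ := hL'.exists_isOpen_preimage_eq (le_max_right n m) hW
    refine ⟨max n m, V' ×ˢ W', hV'.prod hW', ⟨?_, ?_⟩, fun y hy => hAB ⟨?_, ?_⟩⟩
    · exact (Set.ext_iff.1 eV x.1).2 hxV
    · exact (Set.ext_iff.1 eW x.2).2 hxW
    · exact hVA ((Set.ext_iff.1 eV y.1).1 hy.1)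
    · exact hWB ((Set.ext_iff.1 eW y.2).1 hy.2)

/-- The connecting maps respect the two summands, so a thread stays in the summand where it starts
and is a thread of `F` or of `G`. -/
theorem PreservesSeqLimit.sum {F G : TopCat.{u} ⥤ TopCat.{u}} {D : ℕ → TopCat.{u}}
    {p : ∀ n, D (n + 1) ⟶ D n} (hF : PreservesSeqLimit F D p) (hG : PreservesSeqLimit G D p) :
    PreservesSeqLimit (sumFunctor F G) D p := by
  intro L π h
  have hL := hF L π h
  have hL' := hG L π h
  refine ⟨fun n => by rw [← Functor.map_comp, h.compat], fun x y hxy => ?_, fun s hs => ?_,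
    fun U hU x hx => ?_⟩
  · rcases x with x | x <;> rcases y with y | y
    · exact congrArg Sum.inl (hL.injective _ _ fun n => Sum.inl_injective (hxy n))
    · exact absurd (hxy 0) Sum.inl_ne_inr
    · exact absurd (hxy 0) Sum.inr_ne_inl
    · exact congrArg Sum.inr (hL'.injective _ _ fun n => Sum.inr_injective (hxy n))
  · have hs' : ∀ n, Sum.map (F.map (p n)).hom (G.map (p n)).hom (s (n + 1)) = s n := hs
    rcases h0 : s 0 with a | b
    · have : ∀ n, ∃ a, s n = Sum.inl a := fun n => by
        induction n with
        | zero => exact ⟨a, h0⟩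
        | succ n ih =>
          obtain ⟨a, ha⟩ := ih
          rcases hn : s (n + 1) with c | c
          · exact ⟨c, rfl⟩
          · have := hs' n
            rw [hn, ha] at this
            exact absurd this Sum.inr_ne_inl
      choose t ht using this
      obtain ⟨x, hx⟩ := hL.exists_thread t fun n => by
        have := hs' n
        rw [ht, ht] at this
        exact Sum.inl_injective this
      exact ⟨Sum.inl x, fun n => (congrArg Sum.inl (hx n)).trans (ht n).symm⟩
    · have : ∀ n, ∃ a, s n = Sum.inr a := fun n => by
        induction n with
        | zero => exact ⟨b, h0⟩
        | succ n ih =>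
          obtain ⟨a, ha⟩ := ih
          rcases hn : s (n + 1) with c | c
          · have := hs' n
            rw [hn, ha] at this
            exact absurd this Sum.inl_ne_inr
          · exact ⟨c, rfl⟩
      choose t ht using this
      obtain ⟨x, hx⟩ := hL'.exists_thread t fun n => by
        have := hs' n
        rw [ht, ht] at this
        exact Sum.inr_injective this
      exact ⟨Sum.inr x, fun n => (congrArg Sum.inr (hx n)).trans (ht n).symm⟩
  · have hU' := isOpen_sum_iff.1 hU
    rcases x with x | x
    · obtain ⟨n, W, hW, hxW, hWU⟩ := hL.basis _ hU'.1 x hx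
      refine ⟨n, Sum.inl '' W, isOpenMap_inl W hW, Set.mem_image_of_mem _ hxW, ?_⟩
      rintro (y | y) ⟨z, hz, e⟩
      · exact hWU (show F.map (π n) y ∈ W from Sum.inl_injective e ▸ hz)
      · exact absurd e Sum.inl_ne_inr
    · obtain ⟨n, W, hW, hxW, hWU⟩ := hL'.basis _ hU'.2 x hx
      refine ⟨n, Sum.inr '' W, isOpenMap_inr W hW, Set.mem_image_of_mem _ hxW, ?_⟩
      rintro (y | y) ⟨z, hz, e⟩
      · exact absurd e Sum.inr_ne_inl
      · exact hWU (show G.map (π n) y ∈ W from Sum.inr_injective e ▸ hz)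

theorem preservesSeqLimit_const (A : TopCat.{u}) (D : ℕ → TopCat.{u})
    (p : ∀ n, D (n + 1) ⟶ D n) :
    PreservesSeqLimit ((Functor.const TopCat.{u}).obj A) D p := fun L π _ =>
  ⟨fun _ => rfl, fun _ _ hxy => hxy 0, fun s hs => ⟨s 0, fun n => by
    induction n with
    | zero => rfl
    | succ n ih => exact ih.trans (hs n).symm⟩,
  fun U hU _ hx => ⟨0, U, hU, hx, subset_rfl⟩⟩

/-- The sequence is fixed throughout the induction, since the grammar has no composition. Hence
nothing is needed about how the constituents of `F` act on Hausdorff or stably compact spaces. -/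
theorem IsPolynomialOver.preservesSeqLimit {𝒱 : Set (TopCat.{u} ⥤ TopCat.{u})}
    {D : ℕ → TopCat.{u}} {p : ∀ n, D (n + 1) ⟶ D n} (h : ∀ V ∈ 𝒱, PreservesSeqLimit V D p)
    {F : TopCat.{u} ⥤ TopCat.{u}} (hF : IsPolynomialOver 𝒱 F) : PreservesSeqLimit F D p := by
  induction hF with
  | sum _ _ ihF ihG => exact ihF.sum ihG
  | prod _ _ ihF ihG => exact ihF.prod ihG
  | const A => exact preservesSeqLimit_const A D p
  | id => exact fun L π hL => hL
  | vietoris hV => exact h _ hV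
  | iso e _ ih => exact ih.of_iso e

/-- The map `F f` is the composition of `G f` with bijections. -/
theorem map_eq_iso_comp {F G : TopCat.{u} ⥤ TopCat.{u}} (e : F ≅ G) {X Y : TopCat.{u}}
    (f : X ⟶ Y) : ⇑(G.map f) = TopCat.homeoOfIso (e.app Y) ∘ F.map f ∘
      TopCat.homeoOfIso (e.app X).symm := by
  ext x
  exact ConcreteCategory.congr_hom (by simp : G.map f = e.inv.app X ≫ F.map f ≫ e.hom.app Y) x

theorem IsPolynomialOver.map_injective {𝒱 : Set (TopCat.{u} ⥤ TopCat.{u})} {X Y : TopCat.{u}}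
    {f : X ⟶ Y} (hf : Function.Injective f) (h : ∀ V ∈ 𝒱, Function.Injective (V.map f))
    {F : TopCat.{u} ⥤ TopCat.{u}} (hF : IsPolynomialOver 𝒱 F) :
    Function.Injective (F.map f) := by
  induction hF with
  | sum _ _ ihF ihG => exact ihF.sumMap ihG
  | prod _ _ ihF ihG => exact ihF.prodMap ihG
  | const A => exact Function.injective_id
  | id => exact hf
  | vietoris hV => exact h _ hV
  | iso e _ ih =>
    rw [map_eq_iso_comp e]
    exact (Homeomorph.injective _).comp (ih.comp (Homeomorph.injective _))

theorem isEmbedding_sumMap {A B C D : Type*} [TopologicalSpace A] [TopologicalSpace B]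
    [TopologicalSpace C] [TopologicalSpace D] {f : A → C} {g : B → D} (hf : IsEmbedding f)
    (hg : IsEmbedding g) : IsEmbedding (Sum.map f g) := by
  refine ⟨⟨le_antisymm (hf.continuous.sumMap hg.continuous).le_induced fun U hU => ?_⟩,
    hf.injective.sumMap hg.injective⟩
  obtain ⟨hA, hB⟩ := isOpen_sum_iff.1 hU
  obtain ⟨V, hV, eV⟩ := hf.isInducing.isOpen_iff.1 hA
  obtain ⟨W, hW, eW⟩ := hg.isInducing.isOpen_iff.1 hB
  refine isOpen_induced_iff.2 ⟨Sum.inl '' V ∪ Sum.inr '' W,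
    (isOpenMap_inl V hV).union (isOpenMap_inr W hW), ?_⟩
  ext (x | x)
  · simpa using Set.ext_iff.1 eV x
  · simpa using Set.ext_iff.1 eW x

theorem IsPolynomialOver.isEmbedding_map {𝒱 : Set (TopCat.{u} ⥤ TopCat.{u})} {X Y : TopCat.{u}}
    {f : X ⟶ Y} (hf : IsEmbedding f) (h : ∀ V ∈ 𝒱, IsEmbedding (V.map f))
    {F : TopCat.{u} ⥤ TopCat.{u}} (hF : IsPolynomialOver 𝒱 F) : IsEmbedding (F.map f) := by
  induction hF with
  | sum _ _ ihF ihG => exact isEmbedding_sumMap ihF ihG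
  | prod _ _ ihF ihG => exact ihF.prodMap ihG
  | const A => exact IsEmbedding.id
  | id => exact hf
  | vietoris hV => exact h _ hV
  | iso e _ ih =>
    rw [map_eq_iso_comp e]
    exact (Homeomorph.isEmbedding _).comp (ih.comp (Homeomorph.isEmbedding _))

/-- If the functors in `𝒱` are embedded in functors in `𝒲`, then polynomial functors over `𝒱` are
embedded in polynomial functors over `𝒲`. -/
theorem IsPolynomialOver.exists_isEmbeddedSubfunctor {𝒱 𝒲 : Set (TopCat.{u} ⥤ TopCat.{u})}
    (h : ∀ V ∈ 𝒱, ∃ W ∈ 𝒲, IsEmbeddedSubfunctor V W) {G : TopCat.{u} ⥤ TopCat.{u}}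
    (hG : IsPolynomialOver 𝒱 G) :
    ∃ F : TopCat.{u} ⥤ TopCat.{u}, IsPolynomialOver 𝒲 F ∧ IsEmbeddedSubfunctor G F := by
  induction hG with
  | sum _ _ ihF ihG =>
    obtain ⟨F, hF, σ, hσ⟩ := ihF
    obtain ⟨G, hG, τ, hτ⟩ := ihG
    refine ⟨_, hF.sum hG, ⟨fun X => TopCat.ofHom ⟨Sum.map (σ.app X).hom (τ.app X).hom,
      (σ.app X).hom.continuous.sumMap (τ.app X).hom.continuous⟩, fun X Y f => ?_⟩,
      fun X => isEmbedding_sumMap (hσ X) (hτ X)⟩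
    ext (x | x)
    · exact congrArg Sum.inl (ConcreteCategory.congr_hom (σ.naturality f) x)
    · exact congrArg Sum.inr (ConcreteCategory.congr_hom (τ.naturality f) x)
  | prod _ _ ihF ihG =>
    obtain ⟨F, hF, σ, hσ⟩ := ihF
    obtain ⟨G, hG, τ, hτ⟩ := ihG
    refine ⟨_, hF.prod hG, ⟨fun X => TopCat.ofHom ⟨Prod.map (σ.app X).hom (τ.app X).hom,
      (σ.app X).hom.continuous.prodMap (τ.app X).hom.continuous⟩, fun X Y f => ?_⟩,
      fun X => (hσ X).prodMap (hτ X)⟩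
    ext x
    exact Prod.ext (ConcreteCategory.congr_hom (σ.naturality f) x.1)
      (ConcreteCategory.congr_hom (τ.naturality f) x.2)
  | const A => exact ⟨_, .const A, 𝟙 _, fun _ => IsEmbedding.id⟩
  | id => exact ⟨_, .id, 𝟙 _, fun _ => IsEmbedding.id⟩
  | vietoris hV =>
    obtain ⟨W, hW, hVW⟩ := h _ hV
    exact ⟨W, .vietoris hW, hVW⟩
  | iso e _ ih =>
    obtain ⟨F, hF, σ, hσ⟩ := ih
    exact ⟨F, hF, e.inv ≫ σ, fun X =>
      (hσ X).comp (TopCat.homeoOfIso (e.app X).symm).isEmbedding⟩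

/-! ### The compact Vietoris functor preserves limits of sequences of Hausdorff spaces -/

section Compact

variable {D : ℕ → TopCat.{u}} {p : ∀ n, D (n + 1) ⟶ D n} {L : TopCat.{u}} {π : ∀ n, L ⟶ D n}

/-- A point outside a closed set is already separated from it by an open set at some finite stage.
-/
theorem IsSeqLimit.closed_ext (h : IsSeqLimit D p L π) {A B : Set L} (hB : IsClosed B)
    (hAB : ∀ n, π n '' A ⊆ closure (π n '' B)) : A ⊆ B := by
  intro x hx
  by_contra hxB
  obtain ⟨n, W, hW, hxW, hWB⟩ := h.basis Bᶜ hB.isOpen_compl x hxB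
  obtain ⟨_, hyW, y, hy, rfl⟩ :=
    mem_closure_iff.1 (hAB n (Set.mem_image_of_mem _ hx)) W hW hxW
  exact hWB hyW hy

theorem IsSeqLimit.t2Space (h : IsSeqLimit D p L π) (hD : ∀ n, T2Space (D n)) : T2Space L := by
  refine T2Space.of_injective_continuous (f := fun x n => π n x)
    (fun x y hxy => h.injective x y (congrFun hxy))
    (continuous_pi fun n => (π n).hom.continuous)

theorem IsSeqLimit.isInducing (h : IsSeqLimit D p L π) :
    IsInducing (fun (x : L) (n : ℕ) => π n x) := by
  have hc : Continuous (fun (x : L) (n : ℕ) => π n x) :=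
    continuous_pi fun n => (π n).hom.continuous
  refine ⟨le_antisymm hc.le_induced fun U hU => ?_⟩
  refine (@isOpen_iff_forall_mem_open _ (TopologicalSpace.induced _ _) U).2 ?_
  intro x hx
  obtain ⟨n, W, hW, hxW, hWU⟩ := h.basis U hU x hx
  exact ⟨π n ⁻¹' W, hWU, isOpen_induced_iff.2 ⟨(fun s => s n) ⁻¹' W,
    hW.preimage (continuous_apply n), rfl⟩, hxW⟩

end Compact

/-- A point of the `n`-th term of a sequence of surjections extends to a thread. -/
theorem exists_thread_of_surjOn {X : ℕ → Type u} (p : ∀ n, X (n + 1) → X n) {K : ∀ n, Set (X n)}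
    (hK : ∀ n, p n '' K (n + 1) = K n) (n : ℕ) {x : X n} (hx : x ∈ K n) :
    ∃ s : ∀ n, X n, (∀ n, p n (s (n + 1)) = s n) ∧ (∀ n, s n ∈ K n) ∧ s n = x := by
  -- From stage 0, preimages are chosen successively. For `n + 1` the sequence is shifted by one and
  -- the missing first entry is recovered by projecting.
  induction n generalizing X with
  | zero =>
    choose g hg using fun n (y : K n) => ((hK n).symm ▸ y.2 : (y : X n) ∈ p n '' K (n + 1))
    let s : ∀ n, K n := fun n =>
      Nat.rec (motive := fun n => K n) ⟨x, hx⟩ (fun n y => ⟨g n y, (hg n y).1⟩) n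
    exact ⟨fun n => s n, fun n => (hg n (s n)).2, fun n => (s n).2, rfl⟩
  | succ n ih =>
    obtain ⟨s, hs, hsK, hsx⟩ := ih (X := fun n => X (n + 1)) (K := fun n => K (n + 1))
      (fun n => p (n + 1)) (fun n => hK (n + 1)) hx
    refine ⟨fun n => Nat.casesOn n (p 0 (s 0)) s, fun n => ?_, fun n => ?_, hsx⟩
    · cases n with
      | zero => rfl
      | succ n => exact hs n
    · cases n with
      | zero => exact hK 0 ▸ Set.mem_image_of_mem _ (hsK 0)
      | succ n => exact hsK n

theorem preservesSeqLimit_compactVietoris {D : ℕ → TopCat.{u}} {p : ∀ n, D (n + 1) ⟶ D n}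
    (hD : ∀ n, T2Space (D n)) : PreservesSeqLimit compactVietoris D p := by
  intro L π h
  have hL := h.t2Space hD
  have compat : ∀ n, compactVietoris.map (π (n + 1)) ≫ compactVietoris.map (p n) =
      compactVietoris.map (π n) := fun n => by rw [← Functor.map_comp, h.compat]
  refine ⟨compat, fun (A : Compacts L) (B : Compacts L) hAB => ?_, fun s hs => ?_, ?_⟩
  · have hAB' : ∀ n, π n '' A = π n '' B := fun n => congrArg (SetLike.coe (A := Compacts (D n))) (hAB n)
    refine Compacts.ext (Set.Subset.antisymm ?_ ?_)
    · exact h.closed_ext B.isCompact.isClosed fun n => (hAB' n).subset.trans subset_closure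
    · exact h.closed_ext A.isCompact.isClosed fun n => (hAB' n).superset.trans subset_closure
  · let K : ∀ n, Compacts (D n) := s
    have hs' : ∀ n, p n '' K (n + 1) = K n := fun n =>
      congrArg (SetLike.coe (A := Compacts (D n))) (hs n)
    -- This is where the Hausdorff property of the stages makes the space of threads closed in the
    -- product.
    have hcl : IsClosed {t : ∀ n, D n | ∀ n, p n (t (n + 1)) = t n} := by
      rw [Set.ofPred_forall]
      exact isClosed_iInter fun n => isClosed_eq
        ((p n).hom.continuous.comp (continuous_apply (n + 1))) (continuous_apply n)
    have hrange : Set.range (fun (x : L) (n : ℕ) => π n x) =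
        {t : ∀ n, D n | ∀ n, p n (t (n + 1)) = t n} := by
      refine Set.Subset.antisymm ?_ fun t ht => ?_
      · rintro _ ⟨x, rfl⟩ n
        exact ConcreteCategory.congr_hom (h.compat n) x
      · obtain ⟨x, hx⟩ := h.exists_thread t ht
        exact ⟨x, funext hx⟩
    have hemb : IsClosedEmbedding (fun (x : L) (n : ℕ) => π n x) :=
      ⟨⟨h.isInducing, fun x y hxy => h.injective x y (congrFun hxy)⟩, by rwa [hrange]⟩
    have hcomp := hemb.isCompact_preimage (isCompact_univ_pi fun n => (K n).isCompact)
    refine ⟨(⟨_, hcomp⟩ : Compacts L), fun n => Compacts.ext (Set.Subset.antisymm ?_ fun x hx => ?_)⟩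
    · rintro _ ⟨x, hx, rfl⟩
      exact hx n trivial
    · obtain ⟨t, ht, htK, htx⟩ := exists_thread_of_surjOn (X := fun n => D n)
        (K := fun n => K n) (fun n => p n) hs' n hx
      obtain ⟨y, hy⟩ := h.exists_thread t ht
      exact ⟨y, fun m _ => Set.mem_of_eq_of_mem (hy m) (htK m), (hy n).trans htx⟩
  · refine seq_basis_of_generateFrom (D := fun n => compactVietoris.obj (D n)) compat
      (induced_generateFrom_eq ..) ?_
    rintro _ ⟨_, ⟨U, hU, rfl⟩ | ⟨U, hU, rfl⟩, rfl⟩ (A : Compacts L) hA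
    · obtain ⟨n, W, hW, hAW, hWU⟩ : ∃ n, ∃ W : Set (D n), IsOpen W ∧ (A : Set L) ⊆ π n ⁻¹' W ∧
          π n ⁻¹' W ⊆ U := by
        -- Compactness of `A` leaves finitely many basic neighbourhoods inside `U`; they are moved
        -- to a common stage and united there.
        refine A.isCompact.induction_on (p := fun S => ∃ n, ∃ W : Set (D n), IsOpen W ∧
          S ⊆ π n ⁻¹' W ∧ π n ⁻¹' W ⊆ U) ?_ ?_ ?_ ?_
        · exact ⟨0, ∅, isOpen_empty, Set.empty_subset _, Set.empty_subset _⟩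
        · rintro S T hST ⟨n, W, hW, hTW, hWU⟩
          exact ⟨n, W, hW, hST.trans hTW, hWU⟩
        · rintro S T ⟨n, V, hV, hSV, hVU⟩ ⟨m, W, hW, hTW, hWU⟩
          obtain ⟨V', hV', eV⟩ := h.exists_isOpen_preimage_eq (le_max_left n m) hV
          obtain ⟨W', hW', eW⟩ := h.exists_isOpen_preimage_eq (le_max_right n m) hW
          refine ⟨max n m, V' ∪ W', hV'.union hW', ?_, ?_⟩ <;> rw [Set.preimage_union, eV, eW]
          · exact Set.union_subset_union hSV hTW
          · exact Set.union_subset hVU hWU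
        · intro x hx
          obtain ⟨n, W, hW, hxW, hWU⟩ := h.basis U hU x (hA hx)
          exact ⟨_, mem_nhdsWithin_of_mem_nhds
            ((hW.preimage (π n).hom.continuous).mem_nhds hxW), n, W, hW, subset_rfl, hWU⟩
      refine ⟨n, _, Compacts.isOpen_subsets_of_isOpen hW, Set.image_subset_iff.2 hAW, ?_⟩
      exact fun (B : Compacts L) hB => (Set.image_subset_iff.1 hB).trans hWU
    · obtain ⟨x, hxA, hxU⟩ : ((A : Set L) ∩ U).Nonempty := hA
      obtain ⟨n, W, hW, hxW, hWU⟩ := h.basis U hU x hxU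
      refine ⟨n, _, Compacts.isOpen_inter_nonempty_of_isOpen hW,
        ⟨_, Set.mem_image_of_mem _ hxA, hxW⟩, ?_⟩
      rintro (B : Compacts L) ⟨_, ⟨y, hy, rfl⟩, hyW⟩
      exact ⟨y, hy, hWU hyW⟩

/-! ### The patch topology of a stably compact space -/

/-- The patch topology, generated by the open sets and the complements of compact saturated sets. -/
@[reducible]
def patchTopology (X : Type u) [TopologicalSpace X] : TopologicalSpace X :=
  generateFrom ({U | IsOpen U} ∪ {V | ∃ K, IsCompact K ∧ IsSaturated K ∧ V = Kᶜ})

section Patch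

variable {X : Type u} [TopologicalSpace X]

theorem isOpen_patch_of_isOpen {U : Set X} (hU : IsOpen U) : IsOpen[patchTopology X] U :=
  isOpen_generateFrom_of_mem (Or.inl hU)

theorem isClosed_patch_of_isClosed {A : Set X} (hA : IsClosed A) : IsClosed[patchTopology X] A :=
  @IsClosed.mk X (patchTopology X) A (isOpen_patch_of_isOpen hA.isOpen_compl)

theorem isClosed_patch_of_isCompact {K : Set X} (hK : IsCompact K) (hs : IsSaturated K) :
    IsClosed[patchTopology X] K :=
  @IsClosed.mk X (patchTopology X) K (isOpen_generateFrom_of_mem (Or.inr ⟨K, hK, hs, rfl⟩))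

theorem isSaturated_univ : IsSaturated (Set.univ : Set X) :=
  isOpen_univ.nhdsKer_eq

theorem IsSaturated.preimage {Y : Type u} [TopologicalSpace Y] {f : X → Y} (hf : Continuous f)
    {K : Set Y} (hK : IsSaturated K) : IsSaturated (f ⁻¹' K) := by
  refine Set.Subset.antisymm (fun x hx => ?_) subset_nhdsKer
  obtain ⟨y, hy, hxy⟩ := mem_nhdsKer_iff_specializes.1 hx
  exact hK.subset (mem_nhdsKer_iff_specializes.2 ⟨f y, hy, hxy.map hf⟩)

theorem IsSaturated.inter {K L : Set X} (hK : IsSaturated K) (hL : IsSaturated L) :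
    IsSaturated (K ∩ L) :=
  Set.Subset.antisymm (Set.subset_inter
    ((nhdsKer_mono Set.inter_subset_left).trans hK.subset)
    ((nhdsKer_mono Set.inter_subset_right).trans hL.subset)) subset_nhdsKer

theorem IsStablyCompact.compactSpace (h : IsStablyCompact X) : CompactSpace X :=
  ⟨by simpa using h.coherent ∅ Set.finite_empty (by simp)⟩

theorem IsStablyCompact.isCompact_inter (h : IsStablyCompact X) {K L : Set X} (hK : IsCompact K)
    (hK' : IsSaturated K) (hL : IsCompact L) (hL' : IsSaturated L) : IsCompact (K ∩ L) := by
  simpa using h.coherent {K, L} (Set.toFinite _) (by simp [hK, hK', hL, hL'])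

/-- Every open neighbourhood of a point contains a compact saturated neighbourhood. -/
theorem IsStablyCompact.exists_isCompact_isSaturated (h : IsStablyCompact X) {x : X} {U : Set X}
    (hU : IsOpen U) (hx : x ∈ U) :
    ∃ V K, IsOpen V ∧ x ∈ V ∧ V ⊆ K ∧ K ⊆ U ∧ IsCompact K ∧ IsSaturated K := by
  have := h.locallyCompact
  obtain ⟨K, hK, hxK, hKU⟩ := exists_compact_subset hU hx
  exact ⟨interior K, nhdsKer K, isOpen_interior, hxK, interior_subset.trans subset_nhdsKer,
    nhdsKer_minimal hKU hU, hK.nhdsKer, nhdsKer_nhdsKer K⟩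

/-- Suppose an ultrafilter has no patch limit. Then every point in all its compact saturated members
lies in some open set outside the ultrafilter. Well-filteredness gives one compact member covered by
such open sets, and a finite subcover puts one of them in the ultrafilter. -/
theorem IsStablyCompact.compactSpace_patch (h : IsStablyCompact X) :
    @CompactSpace X (patchTopology X) := by
  refine (@isCompact_univ_iff X (patchTopology X)).1 ?_
  refine (@isCompact_iff_ultrafilter_le_nhds X (patchTopology X) _).2 fun 𝓕 _ => ?_
  have hX := h.compactSpace
  by_contra hcon
  let 𝒦 : Set (Set X) := {K | (IsCompact K ∧ IsSaturated K) ∧ K ∈ 𝓕}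
  have hsub : ⋂₀ 𝒦 ⊆ ⋃₀ {U | IsOpen U ∧ U ∉ 𝓕} := by
    intro x hx
    by_contra hxU
    refine hcon ⟨x, trivial, ?_⟩
    rw [nhds_generateFrom]
    refine le_iInf₂ fun s hs => Filter.le_principal_iff.2 ?_
    obtain ⟨hxs, hs | ⟨K, hK, hK', rfl⟩⟩ := hs
    · by_contra hsF
      exact hxU ⟨s, ⟨hs, hsF⟩, hxs⟩
    · refine Ultrafilter.compl_mem_iff_notMem.2 fun hKF => ?_
      exact hxs (hx K ⟨⟨hK, hK'⟩, hKF⟩)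
  obtain ⟨K, hK, hKU⟩ := h.wellFiltered 𝒦 ⟨Set.univ, ⟨isCompact_univ, isSaturated_univ⟩,
      Filter.univ_mem⟩
    -- Coherence supplies the directedness: compact saturated members are closed under binary
    -- intersection.
    (fun K hK L hL => ⟨K ∩ L, ⟨⟨h.isCompact_inter hK.1.1 hK.1.2 hL.1.1 hL.1.2,
      hK.1.2.inter hL.1.2⟩, Filter.inter_mem hK.2 hL.2⟩, Set.inter_subset_left,
      Set.inter_subset_right⟩) (fun K hK => hK.1) _ (isOpen_sUnion fun U hU => hU.1) hsub
  rw [Set.sUnion_eq_biUnion] at hKU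
  obtain ⟨T, hT, hTf, hKT⟩ := hK.1.1.elim_finite_subcover_image (fun U hU => hU.1) hKU
  obtain ⟨U, hU, hUF⟩ :=
    (Ultrafilter.finite_biUnion_mem_iff hTf).1 (Filter.mem_of_superset hK.2 hKT)
  exact (hT hU).2 hUF

/-- By T₀ some open set contains just one of the two points. Local compactness puts a compact
saturated neighbourhood inside it, whose complement is a patch-open neighbourhood of the other
point. -/
theorem IsStablyCompact.t2Space_patch (h : IsStablyCompact X) :
    @T2Space X (patchTopology X) := by
  have key : ∀ (x y : X) (U : Set X), IsOpen U → x ∈ U → y ∉ U → ∃ V W : Set X,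
      IsOpen[patchTopology X] V ∧ IsOpen[patchTopology X] W ∧ x ∈ V ∧ y ∈ W ∧ Disjoint V W := by
    intro x y U hU hx hy
    obtain ⟨V, K, hV, hxV, hVK, hKU, hK, hK'⟩ := h.exists_isCompact_isSaturated hU hx
    exact ⟨V, Kᶜ, isOpen_patch_of_isOpen hV, (isClosed_patch_of_isCompact hK hK').1, hxV,
      fun hyK => hy (hKU hyK), Set.disjoint_compl_right_iff_subset.2 hVK⟩
  refine @T2Space.mk X (patchTopology X) fun x y hxy => ?_
  have := h.t0
  obtain ⟨U, hU, ⟨hx, hy⟩ | ⟨hy, hx⟩⟩ := exists_isOpen_xor_mem hxy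
  · exact key x y U hU hx hy
  · obtain ⟨V, W, hV, hW, hyV, hxW, hVW⟩ := key y x U hU hy hx
    exact ⟨W, V, hW, hV, hxW, hyV, hVW.symm⟩

theorem IsSpectralMorphism.continuous_patch {X Y : TopCat.{u}} {f : X ⟶ Y}
    (hf : IsSpectralMorphism f) : Continuous[patchTopology X, patchTopology Y] f := by
  refine continuous_generateFrom_iff.2 ?_
  rintro _ (hU | ⟨K, hK, hK', rfl⟩)
  · exact isOpen_patch_of_isOpen (hU.preimage f.hom.continuous)
  · exact (isClosed_patch_of_isCompact (hf K hK hK') (hK'.preimage f.hom.continuous)).1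

end Patch

/-! ### The lower Vietoris functor preserves limits of sequences of stably compact spaces -/

/-- In a sequence of compact Hausdorff spaces, a thread exists as soon as all partial threads do. -/
theorem exists_thread_of_compactSpace {X : ℕ → Type u} [∀ n, TopologicalSpace (X n)]
    [∀ n, CompactSpace (X n)] [∀ n, T2Space (X n)] {p : ∀ n, X (n + 1) → X n}
    (hp : ∀ n, Continuous (p n)) {A : ∀ n, Set (X n)} (hA : ∀ n, IsClosed (A n)) {n : ℕ}
    {K : Set (X n)} (hK : IsClosed K)
    (h : ∀ k, ∃ t : ∀ n, X n, (∀ m, t m ∈ A m) ∧ (∀ m < k, p m (t (m + 1)) = t m) ∧ t n ∈ K) :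
    ∃ t : ∀ n, X n, (∀ m, t m ∈ A m) ∧ (∀ m, p m (t (m + 1)) = t m) ∧ t n ∈ K := by
  let C : ℕ → Set (∀ n, X n) := fun k =>
    {t | (∀ m, t m ∈ A m) ∧ (∀ m < k, p m (t (m + 1)) = t m) ∧ t n ∈ K}
  have hC : ∀ k, IsClosed (C k) := fun k => by
    refine IsClosed.inter ?_ (IsClosed.inter ?_ (hK.preimage (continuous_apply n)))
    · change IsClosed {t : ∀ n, X n | ∀ m, t m ∈ A m}
      rw [Set.ofPred_forall]
      exact isClosed_iInter fun m => (hA m).preimage (continuous_apply m)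
    · change IsClosed {t : ∀ n, X n | ∀ m < k, p m (t (m + 1)) = t m}
      simp_rw [Set.ofPred_forall]
      exact isClosed_iInter fun m => isClosed_iInter fun _ =>
        isClosed_eq ((hp m).comp (continuous_apply (m + 1))) (continuous_apply m)
  obtain ⟨t, ht⟩ := IsCompact.nonempty_iInter_of_sequence_nonempty_isCompact_isClosed C
    (fun k t ht => ⟨ht.1, fun m hm => ht.2.1 m (hm.trans k.lt_succ_self), ht.2.2⟩) h
    (hC 0).isCompact hC
  rw [Set.mem_iInter] at ht
  exact ⟨t, (ht 0).1, fun m => (ht (m + 1)).2.1 m m.lt_succ_self, (ht 0).2.2⟩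

/-- Below stage `n` the entries are the projections of `y`; above it they are arbitrary, as no
compatibility is required there. -/
theorem exists_partial_thread_of_mem {X : ℕ → Type u} {p : ∀ n, X (n + 1) → X n}
    {A : ∀ n, Set (X n)} (hA : ∀ n, (A n).Nonempty) (hp : ∀ n, Set.MapsTo (p n) (A (n + 1)) (A n))
    (n : ℕ) {y : X n} (hy : y ∈ A n) :
    ∃ t : ∀ n, X n, (∀ m, t m ∈ A m) ∧ (∀ m < n, p m (t (m + 1)) = t m) ∧ t n = y := by
  induction n generalizing X with
  | zero =>
    refine ⟨fun n => Nat.casesOn n y fun n => (hA (n + 1)).some, fun m => ?_, by simp, rfl⟩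
    cases m with
    | zero => exact hy
    | succ m => exact (hA (m + 1)).some_mem
  | succ n ih =>
    obtain ⟨t, ht, htp, hty⟩ := ih (X := fun n => X (n + 1)) (A := fun n => A (n + 1))
      (fun n => hA (n + 1)) (p := fun n => p (n + 1)) (fun n => hp (n + 1)) hy
    refine ⟨fun n => Nat.casesOn n (p 0 (t 0)) t, fun m => ?_, fun m hm => ?_, hty⟩
    · cases m with
      | zero => exact hp 0 (ht 0)
      | succ m => exact ht m
    · cases m with
      | zero => rfl
      | succ m => exact htp m (Nat.lt_of_succ_lt_succ hm)

/-- An open set meeting a closure meets the set itself, so its preimage meets `A (n + 1)`. Climbing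
`k` stages this way and projecting back gives the thread. Only openness of `W` is used, so the
prescribed entry is located in `W` and not at a given point. -/
theorem exists_partial_thread_of_inter_nonempty {X : ℕ → Type u} [∀ n, TopologicalSpace (X n)]
    {p : ∀ n, X (n + 1) → X n} (hp : ∀ n, Continuous (p n)) {A : ∀ n, Set (X n)}
    (hA : ∀ n, closure (p n '' A (n + 1)) = A n) (k n : ℕ) {W : Set (X n)} (hW : IsOpen W)
    (hAW : (A n ∩ W).Nonempty) :
    ∃ t : ∀ n, X n, (∀ m, t m ∈ A m) ∧ (∀ m < n + k, p m (t (m + 1)) = t m) ∧ t n ∈ W := by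
  have hsucc : ∀ n, (A n).Nonempty ↔ (A (n + 1)).Nonempty := fun n => by
    rw [← hA n, closure_nonempty_iff, Set.image_nonempty]
  have hmaps : ∀ n, Set.MapsTo (p n) (A (n + 1)) (A n) := fun n x hx =>
    hA n ▸ subset_closure (Set.mem_image_of_mem _ hx)
  induction k generalizing n with
  | zero =>
    obtain ⟨y, hyA, hyW⟩ := hAW
    have hne : ∀ m, (A m).Nonempty := by
      have h0 : ∀ m, (A m).Nonempty ↔ (A 0).Nonempty := fun m => by
        induction m with
        | zero => rfl
        | succ m ih => rw [← hsucc, ih]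
      exact fun m => (h0 m).2 ((h0 n).1 ⟨y, hyA⟩)
    obtain ⟨t, ht, htp, rfl⟩ := exists_partial_thread_of_mem hne hmaps n hyA
    exact ⟨t, ht, htp, hyW⟩
  | succ k ih =>
    have hne : (A (n + 1) ∩ p n ⁻¹' W).Nonempty := by
      rw [← hA n, closure_inter_open_nonempty_iff hW] at hAW
      exact Set.image_inter_nonempty_iff.1 hAW
    obtain ⟨t, ht, htp, htW⟩ := ih (n + 1) (hW.preimage (hp n)) hne
    refine ⟨t, ht, fun m hm => htp m (by omega), ?_⟩
    rw [← htp n (by omega)]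
    exact htW

theorem preservesSeqLimit_lowerVietoris {D : ℕ → TopCat.{u}} {p : ∀ n, D (n + 1) ⟶ D n}
    (hD : ∀ n, IsStablyCompact (D n)) (hp : ∀ n, IsSpectralMorphism (p n)) :
    PreservesSeqLimit lowerVietoris D p := by
  intro L π h
  have compat : ∀ n, lowerVietoris.map (π (n + 1)) ≫ lowerVietoris.map (p n) =
      lowerVietoris.map (π n) := fun n => by rw [← Functor.map_comp, h.compat]
  refine ⟨compat, fun (A : Closeds L) (B : Closeds L) hAB => ?_, fun s hs => ?_, ?_⟩
  · have hAB' : ∀ n, closure (π n '' A) = closure (π n '' B) := fun n =>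
      congrArg (SetLike.coe (A := Closeds (D n))) (hAB n)
    refine Closeds.ext (Set.Subset.antisymm ?_ ?_)
    · exact h.closed_ext B.isClosed fun n => subset_closure.trans (hAB' n).subset
    · exact h.closed_ext A.isClosed fun n => subset_closure.trans (hAB' n).superset
  · let A : ∀ n, Closeds (D n) := s
    have hA : ∀ n, closure (p n '' A (n + 1)) = A n := fun n =>
      congrArg (SetLike.coe (A := Closeds (D n))) (hs n)
    let B : Closeds L := ⟨⋂ n, π n ⁻¹' A n,
      isClosed_iInter fun n => (A n).isClosed.preimage (π n).hom.continuous⟩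
    refine ⟨B, fun n => Closeds.ext (Set.Subset.antisymm ?_ ?_)⟩
    · refine closure_minimal ?_ (A n).isClosed
      rintro _ ⟨x, hx, rfl⟩
      exact Set.mem_iInter.1 hx n
    · intro x hx
      refine mem_closure_iff.2 fun U hU hxU => ?_
      -- Partial threads need the open set `V`, while the compactness argument needs a patch-closed
      -- set; `K` is placed between `V` and `U` for this purpose.
      obtain ⟨V, K, hV, hxV, hVK, hKU, hK, hK'⟩ := (hD n).exists_isCompact_isSaturated hU hxU
      obtain ⟨t, htA, htp, htK⟩ := @exists_thread_of_compactSpace (fun n => D n)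
        (fun n => patchTopology (D n)) (fun n => (hD n).compactSpace_patch)
        (fun n => (hD n).t2Space_patch) (fun n => p n) (fun n => (hp n).continuous_patch)
        (fun n => A n) (fun n => isClosed_patch_of_isClosed (A n).isClosed) n K
        (isClosed_patch_of_isCompact hK hK') fun k => by
          obtain ⟨t, ht, htp, htV⟩ := exists_partial_thread_of_inter_nonempty
            (X := fun n => D n) (p := fun n => p n) (fun n => (p n).hom.continuous)
            (A := fun n => A n) hA k n hV ⟨x, hx, hxV⟩
          exact ⟨t, ht, fun m hm => htp m (by omega), hVK htV⟩
      obtain ⟨y, hy⟩ := h.exists_thread t htp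
      refine ⟨t n, hKU htK, y, Set.mem_iInter.2 fun m => ?_, hy n⟩
      change π m y ∈ A m
      rw [hy]
      exact htA m
  · refine seq_basis_of_generateFrom (D := fun n => lowerVietoris.obj (D n)) compat rfl ?_
    rintro _ ⟨U, hU, rfl⟩ (A : Closeds L) ⟨x, hxA, hxU⟩
    obtain ⟨n, W, hW, hxW, hWU⟩ := h.basis U hU x hxU
    refine ⟨n, _, isOpen_generateFrom_of_mem ⟨W, hW, rfl⟩,
      ⟨_, subset_closure (Set.mem_image_of_mem _ hxA), hxW⟩, ?_⟩
    rintro (B : Closeds L) hB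
    obtain ⟨_, ⟨y, hy, rfl⟩, hyW⟩ := (closure_inter_open_nonempty_iff hW).1 hB
    exact ⟨y, hy, hWU hyW⟩

/-- For an embedding, `f ⁻¹' closure (f '' A) = A` when `A` is closed, which gives injectivity.
Subbasic opens correspond because an open set meets `closure (f '' A)` exactly when its preimage
meets `A`. -/
theorem isEmbedding_lowerVietoris_map {X Y : TopCat.{u}} {f : X ⟶ Y} (hf : IsEmbedding f) :
    IsEmbedding (lowerVietoris.map f) := by
  have hinj : Function.Injective (lowerVietoris.map f) := fun (A : Closeds X) (B : Closeds X) h => by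
    have hAB : closure (f '' A) = closure (f '' B) :=
      congrArg (SetLike.coe (A := Closeds Y)) h
    have key : ∀ A : Closeds X, f ⁻¹' closure (f '' A) = A := fun A => by
      rw [← hf.closure_eq_preimage_closure_image, A.isClosed.closure_eq]
    exact Closeds.ext (by rw [← key A, hAB, key B])
  refine ⟨⟨le_antisymm (lowerVietoris.map f).hom.continuous.le_induced ?_⟩, hinj⟩
  refine le_generateFrom ?_
  rintro _ ⟨U, hU, rfl⟩
  obtain ⟨W, hW, rfl⟩ := hf.isInducing.isOpen_iff.1 hU
  refine isOpen_induced_iff.2 ⟨_, isOpen_generateFrom_of_mem ⟨W, hW, rfl⟩, ?_⟩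
  ext (A : Closeds X)
  change (closure (f '' (A : Set X)) ∩ W).Nonempty ↔ ((A : Set X) ∩ f ⁻¹' W).Nonempty
  rw [closure_inter_open_nonempty_iff hW, Set.image_inter_nonempty_iff]

/-! ### Final coalgebras of subfunctors -/

section Subfunctor

open Endofunctor

variable {F G : TopCat.{u} ⥤ TopCat.{u}}

/-- Every family of coalgebras maps to a common coalgebra, namely to its coproduct. -/
theorem exists_coalgebra_hom_of_family {ι : Type u} (C : ι → Coalgebra G) :
    ∃ Y : Coalgebra G, ∀ i, Nonempty (C i ⟶ Y) := by
  let V : TopCat.{u} := TopCat.of (Σ i, (C i).V)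
  let inj : ∀ i, (C i).V ⟶ V := fun i => TopCat.ofHom
    ⟨fun x => (⟨i, x⟩ : Σ i, (C i).V), continuous_sigmaMk (σ := fun i => (C i).V)⟩
  let str : V ⟶ G.obj V := TopCat.ofHom
    ⟨fun x => ((C x.1).str ≫ G.map (inj x.1)) x.2,
      continuous_sigma fun i => ((C i).str ≫ G.map (inj i)).hom.continuous⟩
  exact ⟨⟨V, str⟩, fun i => ⟨⟨inj i, rfl⟩⟩⟩

/-- A coalgebra with an injection into `Z` is isomorphic to one carried by a subset of `Z`. -/
theorem exists_coalgebra_on_subset {Z : Type u} (I : Coalgebra G) {m : I.V → Z}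
    (hm : Function.Injective m) :
    ∃ (S : Set Z) (t : TopologicalSpace S) (d : @TopCat.of S t ⟶ G.obj (@TopCat.of S t)),
      Nonempty (I ⟶ (⟨@TopCat.of S t, d⟩ : Coalgebra G)) := by
  let ε : I.V ≃ Set.range m := Equiv.ofInjective m hm
  let t : TopologicalSpace (Set.range m) := coinduced ε inferInstance
  let φ : I.V ≃ₜ Set.range m :=
    { toEquiv := ε
      continuous_toFun := continuous_coinduced_rng
      continuous_invFun := continuous_coinduced_dom.2 (by
        convert continuous_id
        ext x
        exact ε.symm_apply_apply x) }
  let e : I.V ≅ TopCat.of (Set.range m) := TopCat.isoOfHomeo φ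
  exact ⟨Set.range m, t, e.inv ≫ I.str ≫ G.map e.hom, ⟨⟨e.hom, by simp⟩⟩⟩

/-- If `G` is a subfunctor of `F` and the behaviour maps of `G`-coalgebras into a final
`F`-coalgebra factor through `G`-coalgebras on which the behaviour map is injective, then `G` has a
final coalgebra. -/
theorem hasFinalCoalgebra_of_factorization (hF : HasFinalCoalgebra F) (σ : G ⟶ F)
    (hσ : ∀ (Z : Coalgebra F) (X : Coalgebra G) (_ : (Coalgebra.functorOfNatTrans σ).obj X ⟶ Z),
      ∃ (I : Coalgebra G) (_ : X ⟶ I) (m : (Coalgebra.functorOfNatTrans σ).obj I ⟶ Z),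
        Function.Injective m.f) :
    HasFinalCoalgebra G := by
  have : HasTerminal (Coalgebra F) := hF
  let Z : Coalgebra F := ⊤_ (Coalgebra F)
  -- All `G`-coalgebra structures on subsets of `Z.V`, with every topology and not only the subspace
  -- one; this index type lives in `Type u`, so the coproduct exists.
  let ι := Σ (S : Set Z.V) (t : TopologicalSpace S), @TopCat.of S t ⟶ G.obj (@TopCat.of S t)
  obtain ⟨Y, hY⟩ := exists_coalgebra_hom_of_family
    fun i : ι => (⟨@TopCat.of i.1 i.2.1, i.2.2⟩ : Coalgebra G)
  obtain ⟨I, e, m, hm⟩ := hσ Z Y (terminal.from _)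
  have hI : ∀ X : Coalgebra G, Nonempty (X ⟶ I) := fun X => by
    obtain ⟨I', e', m', hm'⟩ := hσ Z X (terminal.from _)
    obtain ⟨S, t, d, ⟨f⟩⟩ := exists_coalgebra_on_subset I' hm'
    obtain ⟨g⟩ := hY ⟨S, t, d⟩
    exact ⟨e' ≫ f ≫ g ≫ e⟩
  refine IsTerminal.hasTerminal (X := I)
    (IsTerminal.ofUniqueHom (fun X => (hI X).some) fun X f => ?_)
  -- Both composites are `F`-coalgebra morphisms into the terminal `Z`, and `m` is injective.
  have h : (Coalgebra.functorOfNatTrans σ).map f ≫ m =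
      (Coalgebra.functorOfNatTrans σ).map (hI X).some ≫ m := Subsingleton.elim _ _
  refine Coalgebra.ext ?_
  ext x
  exact hm (ConcreteCategory.congr_hom (congrArg Coalgebra.Hom.f h) x)

/-- Diagonal fill-in: injectivity of `σ.app I ≫ F.map m` makes the structure map on `I`, defined
through a section of `e`, independent of that section. Its continuity is tested either after
precomposing with the quotient map `e` or after postcomposing with the inducing map. -/
theorem exists_coalgebra_factorization (σ : G ⟶ F) (Z : Coalgebra F) (X : Coalgebra G)
    (b : (Coalgebra.functorOfNatTrans σ).obj X ⟶ Z) {I : TopCat.{u}} (e : X.V ⟶ I) (m : I ⟶ Z.V)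
    (hem : e ≫ m = b.f) (he : Function.Surjective e) (hm : Function.Injective m)
    (hj : Function.Injective (σ.app I ≫ F.map m))
    (hc : IsQuotientMap e ∨ IsInducing (σ.app I ≫ F.map m)) :
    ∃ (I : Coalgebra G) (_ : X ⟶ I) (m : (Coalgebra.functorOfNatTrans σ).obj I ⟶ Z),
      Function.Injective m.f := by
  have hb : (X.str ≫ G.map e) ≫ σ.app I ≫ F.map m = e ≫ m ≫ Z.str := by
    have hb' : (X.str ≫ σ.app X.V) ≫ F.map (e ≫ m) = (e ≫ m) ≫ Z.str := by
      rw [hem]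
      exact b.h
    rw [← Category.assoc e m, ← hb']
    simp
  choose g hg using he
  let d : I → G.obj I := fun i => (X.str ≫ G.map e) (g i)
  have hjd : ∀ i, (σ.app I ≫ F.map m) (d i) = Z.str (m i) := fun i => by
    have := ConcreteCategory.congr_hom hb (g i)
    simp only [TopCat.comp_app, hg] at this ⊢
    exact this
  have hde : ∀ x, d (e x) = (X.str ≫ G.map e) x := fun x =>
    hj ((hjd (e x)).trans (ConcreteCategory.congr_hom hb x).symm)
  have hd : Continuous d := by
    rcases hc with hc | hc
    · rw [hc.continuous_iff, show d ∘ e = X.str ≫ G.map e from funext hde]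
      exact (X.str ≫ G.map e).hom.continuous
    · rw [hc.continuous_iff, show (σ.app I ≫ F.map m) ∘ d = m ≫ Z.str from funext hjd]
      exact (m ≫ Z.str).hom.continuous
  let D : I ⟶ G.obj I := TopCat.ofHom ⟨d, hd⟩
  refine ⟨⟨I, D⟩, ⟨e, ?_⟩, ⟨m, ?_⟩, hm⟩
  · ext x
    exact (hde x).symm
  · ext x
    exact hjd x

/-- The image of the behaviour map carries the quotient topology, so only injectivity of `σ` and of
`F.map m` is needed. -/
theorem hasFinalCoalgebra_of_map_injective (hF : HasFinalCoalgebra F)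
    (hmap : ∀ {X Y : TopCat.{u}} (f : X ⟶ Y), Function.Injective f → Function.Injective (F.map f))
    (hG : IsMonoSubfunctor G F) : HasFinalCoalgebra G := by
  obtain ⟨σ, hσ⟩ := hG
  refine hasFinalCoalgebra_of_factorization hF σ fun Z X b => ?_
  let e : X.V ⟶ TopCat.of (Quotient (Setoid.ker b.f)) :=
    TopCat.ofHom ⟨Quotient.mk _, continuous_quotient_mk'⟩
  let m : TopCat.of (Quotient (Setoid.ker b.f)) ⟶ Z.V :=
    TopCat.ofHom ⟨Quotient.lift b.f fun _ _ h => h, b.f.hom.continuous.quotient_lift _⟩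
  have hm : Function.Injective m := Setoid.kerLift_injective _
  exact exists_coalgebra_factorization σ Z X b e m rfl Quotient.mk_surjective hm
    ((hmap m hm).comp ((TopCat.mono_iff_injective _).1 (hσ _))) (Or.inl isQuotientMap_quotient_mk')

/-- Here the image carries the subspace topology: `F` is only assumed to preserve embeddings, so `m`
must be one, and the embedding `σ.app _ ≫ F.map m` then yields continuity. -/
theorem hasFinalCoalgebra_of_isEmbedding_map (hF : HasFinalCoalgebra F)
    (hmap : ∀ {X Y : TopCat.{u}} (f : X ⟶ Y), IsEmbedding f → IsEmbedding (F.map f))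
    (hG : IsEmbeddedSubfunctor G F) : HasFinalCoalgebra G := by
  obtain ⟨σ, hσ⟩ := hG
  refine hasFinalCoalgebra_of_factorization hF σ fun Z X b => ?_
  let e : X.V ⟶ TopCat.of (Set.range b.f) :=
    TopCat.ofHom ⟨Set.rangeFactorization b.f, b.f.hom.continuous.rangeFactorization⟩
  let m : TopCat.of (Set.range b.f) ⟶ Z.V := TopCat.ofHom ⟨Subtype.val, continuous_subtype_val⟩
  have hj : IsEmbedding (σ.app _ ≫ F.map m) := (hmap m IsEmbedding.subtypeVal).comp (hσ _)
  exact exists_coalgebra_factorization σ Z X b e m rfl Set.rangeFactorization_surjective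
    Subtype.val_injective hj.injective (Or.inr hj.isInducing)

end Subfunctor

/-! ### Final coalgebras of Vietoris polynomial functors -/

theorem t2Space_finalSeq {F : TopCat.{u} ⥤ TopCat.{u}} (hF : RestrictsToHaus F) :
    ∀ n, T2Space (finalSeq F n)
  | 0 => inferInstanceAs (T2Space PUnit)
  | n + 1 => hF _ (t2Space_finalSeq hF n)

theorem isStablyCompact_punit : IsStablyCompact PUnit.{u + 1} where
  t0 := inferInstance
  locallyCompact := inferInstance
  wellFiltered 𝒦 hne hdir h𝒦 U hU hsub := by
    by_contra! hcon
    -- A nonempty `U` is the whole point and contains every `K`. With `U` empty, every `K` not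
    -- contained in it has the point as a member, so the intersection is not contained in `U`.
    have hU : U = ∅ := by
      by_contra hU
      obtain ⟨x, hx⟩ := Set.nonempty_iff_ne_empty.2 hU
      obtain ⟨K, hK⟩ := hne
      exact hcon K hK fun y _ => Subsingleton.elim x y ▸ hx
    refine (Set.notMem_empty PUnit.unit) (hU ▸ hsub fun K hK => ?_)
    obtain ⟨x, hx, _⟩ := Set.not_subset.1 (hcon K hK)
    exact hx
  coherent 𝒦 _ _ := (Set.toFinite _).isCompact

theorem isStablyCompact_finalSeq {F : TopCat.{u} ⥤ TopCat.{u}} (hF : RestrictsToStablyComp F) :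
    ∀ n, IsStablyCompact (finalSeq F n)
  | 0 => isStablyCompact_punit
  | n + 1 => hF.1 _ (isStablyCompact_finalSeq hF n)

theorem isSpectralMorphism_toPoint {X : TopCat.{u}} (hX : IsStablyCompact X) :
    IsSpectralMorphism (toPoint X) := by
  intro K _ _
  have := hX.compactSpace
  by_cases hK : PUnit.unit ∈ K
  · exact (Set.eq_univ_of_forall fun _ => hK : (toPoint X).hom ⁻¹' K = Set.univ) ▸ isCompact_univ
  · exact (Set.eq_empty_of_forall_notMem fun _ => hK : (toPoint X).hom ⁻¹' K = ∅) ▸ isCompact_empty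

theorem isSpectralMorphism_finalSeqMap {F : TopCat.{u} ⥤ TopCat.{u}}
    (hF : RestrictsToStablyComp F) : ∀ n, IsSpectralMorphism (finalSeqMap F n)
  | 0 => isSpectralMorphism_toPoint (isStablyCompact_finalSeq hF 1)
  | n + 1 => hF.2 _ _ _ (isStablyCompact_finalSeq hF (n + 1)) (isStablyCompact_finalSeq hF n)
    (isSpectralMorphism_finalSeqMap hF n)

theorem compactVietoris_map_injective {X Y : TopCat.{u}} (f : X ⟶ Y)
    (hf : Function.Injective f) : Function.Injective (compactVietoris.map f) :=
  fun _ _ h => Compacts.ext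
    (hf.image_injective (congrArg (SetLike.coe (A := Compacts Y)) h))

theorem IsCompactVietorisPolynomial.hasFinalCoalgebra {F : TopCat.{u} ⥤ TopCat.{u}}
    (hF : IsCompactVietorisPolynomial F) (hF' : RestrictsToHaus F) : HasFinalCoalgebra F := by
  refine (IsPolynomialOver.preservesSeqLimit ?_ hF).hasFinalCoalgebra
  rintro _ rfl
  exact preservesSeqLimit_compactVietoris (t2Space_finalSeq hF')

theorem IsLowerVietorisPolynomial.hasFinalCoalgebra {F : TopCat.{u} ⥤ TopCat.{u}}
    (hF : IsLowerVietorisPolynomial F) (hF' : RestrictsToStablyComp F) : HasFinalCoalgebra F := by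
  refine (IsPolynomialOver.preservesSeqLimit ?_ hF).hasFinalCoalgebra
  rintro _ rfl
  exact preservesSeqLimit_lowerVietoris (isStablyCompact_finalSeq hF')
    (isSpectralMorphism_finalSeqMap hF')

theorem IsEmbeddedSubfunctor.isMonoSubfunctor {F G : TopCat.{u} ⥤ TopCat.{u}}
    (h : IsEmbeddedSubfunctor G F) : IsMonoSubfunctor G F := by
  obtain ⟨σ, hσ⟩ := h
  exact ⟨σ, fun X => (TopCat.mono_iff_injective _).2 (hσ X).injective⟩

theorem IsCompactVietorisPolynomial.hasFinalCoalgebra_of_isMonoSubfunctor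
    {F G : TopCat.{u} ⥤ TopCat.{u}} (hF : IsCompactVietorisPolynomial F)
    (hF' : RestrictsToHaus F) (hG : IsMonoSubfunctor G F) : HasFinalCoalgebra G := by
  refine hasFinalCoalgebra_of_map_injective (hF.hasFinalCoalgebra hF') (fun f hf => ?_) hG
  refine IsPolynomialOver.map_injective hf ?_ hF
  rintro _ rfl
  exact compactVietoris_map_injective f hf

theorem IsLowerVietorisPolynomial.hasFinalCoalgebra_of_isEmbeddedSubfunctor
    {F G : TopCat.{u} ⥤ TopCat.{u}} (hF : IsLowerVietorisPolynomial F)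
    (hF' : RestrictsToStablyComp F) (hG : IsEmbeddedSubfunctor G F) : HasFinalCoalgebra G := by
  refine hasFinalCoalgebra_of_isEmbedding_map (hF.hasFinalCoalgebra hF') (fun f hf => ?_) hG
  refine IsPolynomialOver.isEmbedding_map hf ?_ hF
  rintro _ rfl
  exact isEmbedding_lowerVietoris_map hf

theorem isEmbeddedSubfunctor_compactVietorisOf (P : ∀ X : TopCat.{u}, Set X → Prop)
    (hP : ∀ (X Y : TopCat.{u}) (f : X ⟶ Y) (K : Set X), P X K → P Y (f.hom '' K)) :
    IsEmbeddedSubfunctor (compactVietorisOf P hP) compactVietoris :=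
  ⟨{ app := fun _ => TopCat.ofHom ⟨Subtype.val, continuous_subtype_val⟩
     naturality := fun _ _ _ => rfl }, fun _ => IsEmbedding.subtypeVal⟩

theorem restrictsToHaus_compactVietoris : RestrictsToHaus compactVietoris.{u} :=
  fun X _ => inferInstanceAs (T2Space (Compacts X))

theorem isCompactVietorisPolynomial_compactVietoris :
    IsCompactVietorisPolynomial compactVietoris.{u} :=
  .vietoris rfl

theorem mainTheorem12 :
    -- subfunctors of compact Vietoris polynomial functors
    (∀ F : TopCat.{u} ⥤ TopCat.{u}, IsCompactVietorisPolynomial F → RestrictsToHaus F →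
      ∀ G : TopCat.{u} ⥤ TopCat.{u}, IsMonoSubfunctor G F → HasFinalCoalgebra G) ∧
    -- the nonempty, the finite and the connected variant
    (∀ W ∈ ({nonemptyCompactVietoris, finiteCompactVietoris, connectedCompactVietoris} :
        Set (TopCat.{u} ⥤ TopCat.{u})),
      IsEmbeddedSubfunctor W compactVietoris ∧ HasFinalCoalgebra W) ∧
    (∀ G : TopCat.{u} ⥤ TopCat.{u},
      IsPolynomialOver {compactVietoris, nonemptyCompactVietoris, finiteCompactVietoris,
        connectedCompactVietoris} G →
      ∃ F : TopCat.{u} ⥤ TopCat.{u}, IsCompactVietorisPolynomial F ∧ IsEmbeddedSubfunctor G F) ∧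
    -- subfunctors of lower Vietoris polynomial functors
    (∀ F : TopCat.{u} ⥤ TopCat.{u}, IsLowerVietorisPolynomial F → RestrictsToStablyComp F →
      ∀ G : TopCat.{u} ⥤ TopCat.{u}, IsEmbeddedSubfunctor G F → HasFinalCoalgebra G) := by
  have hW : ∀ W ∈ ({nonemptyCompactVietoris, finiteCompactVietoris, connectedCompactVietoris} :
      Set (TopCat.{u} ⥤ TopCat.{u})), IsEmbeddedSubfunctor W compactVietoris := by
    rintro _ (rfl | rfl | rfl) <;> exact isEmbeddedSubfunctor_compactVietorisOf _ _
  refine ⟨fun F hF hF' G => hF.hasFinalCoalgebra_of_isMonoSubfunctor hF',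
    fun W h => ⟨hW W h, ?_⟩, fun G hG => ?_,
    fun F hF hF' G => hF.hasFinalCoalgebra_of_isEmbeddedSubfunctor hF'⟩
  · exact isCompactVietorisPolynomial_compactVietoris.hasFinalCoalgebra_of_isMonoSubfunctor
      restrictsToHaus_compactVietoris (hW W h).isMonoSubfunctor
  · refine hG.exists_isEmbeddedSubfunctor (𝒲 := {compactVietoris}) fun V hV => ⟨compactVietoris, rfl, ?_⟩
    rcases hV with rfl | hV
    · exact ⟨𝟙 _, fun _ => IsEmbedding.id⟩
    · exact hW V hV
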